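/- For a set $S$ and a map $s\colon S\times S\to S\times S$, let $s_{ij}\colon S^3\to S^3$ be the map that applies $s$ to the components $i,j$ and is the identity on the remaining one. The pair $(S,s)$ is a set-theoretic solution of the Pentagon Equation if $s_{23}s_{13}s_{12}=s_{12}s_{23}$; it is bijective if $s$ is, and finite if $S$ is. A matched pair of groups $(A,G,\sigma,\delta)$ consists of groups $A,G$, a left action $\sigma\colon A\to\mathrm{Sym}(G)$ (so $\sigma_{ab}=\sigma_a\sigma_b$) and a right action $\delta\colon G\to \mathrm{Sym}(A)$ (so $\delta_{xy}=\delta_y\delta_x$) such that $$\sigma_a(xy)=\sigma_a(x)\,\sigma_{\delta_x(a)}(y),\qquad \delta_x(ab)=\delta_{\sigma_b(x)}(a)\,\delta_x(b)$$ for all $a,b\in A$ and $x,y\in G$. Theorem 1.1. Let $(S,s)$ be a finite bijective set-theoretic solution of the Pentagon Equation. Then there are a matched pair of groups $(A,G,\sigma,\delta)$, a set $X$ and permutations $\varphi_a\in\mathrm{Sym}(X)$, $a\in A$, such that, up to identifying $S$ with $X\times A\times G$ along a bijection, $S=X\times A\times G$ and $$s\bigl((\alpha,a,x),(\beta,b,y)\bigr)=\Bigl((\alpha,a,xy),\bigl(\varphi_{b(\delta_x(a))^{-1}}^{-1}\varphi_b(\beta),\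 b(\delta_x(a))^{-1},\ \sigma_{\delta_x(a)}(y)\bigr)\Bigr)\qquad(\star)$$ for all $\alpha,\beta\in X$, $a,b\in A$ and $x,y\in G$. Conversely, for every matched pair of groups $(A,G,\sigma,\delta)$, every set $X$ and all permutations $\varphi_a\in\mathrm{Sym}(X)$, $a\in A$, the map $s$ defined on $S=X\times A\times G$ by $(\star)$ is a bijective set-theoretic solution of the Pentagon Equation. -/

import Mathlib

universe u v₁ v₂ v₃

/-- `s₁₂`: apply `s` to the first and second components of a triple. -/
def pentagon12 {S : Type*} (s : S × S → S × S) : S × S × S → S × S × S :=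
  fun p => ((s (p.1, p.2.1)).1, (s (p.1, p.2.1)).2, p.2.2)

/-- `s₁₃`: apply `s` to the first and third components of a triple. -/
def pentagon13 {S : Type*} (s : S × S → S × S) : S × S × S → S × S × S :=
  fun p => ((s (p.1, p.2.2)).1, p.2.1, (s (p.1, p.2.2)).2)

/-- `s₂₃`: apply `s` to the second and third components of a triple. -/
def pentagon23 {S : Type*} (s : S × S → S × S) : S × S × S → S × S × S :=
  fun p => (p.1, (s (p.2.1, p.2.2)).1, (s (p.2.1, p.2.2)).2)

/-- `(S, s)` is a set-theoretic solution of the Pentagon Equation: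
`s₂₃ s₁₃ s₁₂ = s₁₂ s₂₃` on `S × S × S`. -/
def IsPentagonSolution {S : Type*} (s : S × S → S × S) : Prop :=
  pentagon23 s ∘ pentagon13 s ∘ pentagon12 s = pentagon12 s ∘ pentagon23 s

/-- A matched pair of groups `(A, G, σ, δ)`: a left action `σ` of `A` on the set `G` and a
right action `δ` of `G` on the set `A`, both by permutations, satisfying the two
compatibility conditions. -/
structure MatchedPair (A G : Type*) [Group A] [Group G] where
  /-- The left action, `σ (a * b) = σ a ∘ σ b`. -/
  σ : A →* Equiv.Perm G
  /-- The right action. -/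
  δ : G → Equiv.Perm A
  δ_one : δ 1 = 1
  /-- `δ` is a right action: the product on the right is composition of permutations. -/
  δ_mul : ∀ x y : G, δ (x * y) = δ y * δ x
  σ_mul_apply : ∀ (a : A) (x y : G), σ a (x * y) = σ a x * σ (δ x a) y
  δ_apply_mul : ∀ (x : G) (a b : A), δ x (a * b) = δ (σ b x) a * δ x b

/-- The map `s` on `X × A × G` given by
`s((α,a,x),(β,b,y)) = ((α,a,xy), (φ_c⁻¹ (φ_b β), c, σ_{δ_x(a)}(y)))` with `c = b (δ_x(a))⁻¹`. -/
def matchedPairMap {A G X : Type*} [Group A] [Group G] (M : MatchedPair A G)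
    (φ : A → Equiv.Perm X) :
    (X × A × G) × (X × A × G) → (X × A × G) × (X × A × G)
  | ((α, a, x), (β, b, y)) =>
    ((α, a, x * y),
      ((φ (b * (M.δ x a)⁻¹)).symm (φ b β), b * (M.δ x a)⁻¹, M.σ (M.δ x a) y))

/-! Write `s (x, y) = (x * y, θ x y)`. The Pentagon Equation says that `*` is associative, `θ x (y *
z) = θ x y * θ (x * y) z` and `θ (θ x y) ∘ θ (x * y) = θ y`. Finiteness and bijectivity make every
idempotent a right identity (`mul_idempotent`), so each element is an idempotent times an element of
a group `e S`, and every `θ x` is a permutation (`injective`). By the third law the maps `θ x` form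
a group `A`. For an idempotent `e` with `θ e = 1`, the group `G = e S` acts on `A` by `θ p ↦ θ (p *
x)`, and `A` acts on `G` by `x ↦ e * a x`; `X` is the set of idempotents with trivial `θ`. In these
coordinates every `φ` is trivial. The converse is a computation resting on `δ_σ_inv`. -/

/-- The component `θ` of a bijective solution `s (x, y) = (x * y, θ x y)` of the Pentagon
Equation on a semigroup. -/
structure IsBijectivePentagon {S : Type*} [Semigroup S] (θ : S → S → S) : Prop where
  map_mul : ∀ x y z, θ x (y * z) = θ x y * θ (x * y) z
  comp : ∀ x y z, θ (θ x y) (θ (x * y) z) = θ y z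
  bijective : Function.Bijective fun p : S × S => (p.1 * p.2, θ p.1 p.2)

theorem Set.mem_of_apply_mem_of_mapsTo {α : Type*} [Finite α] {f : α → α}
    (hf : Function.Injective f) {T : Set α} (hT : Set.MapsTo f T T) {x : α} (hx : f x ∈ T) :
    x ∈ T := by
  have h : f '' T = T := Set.eq_of_subset_of_ncard_le hT.image_subset
    (Set.ncard_image_of_injective T hf).ge (Set.toFinite T)
  rw [← h] at hx
  exact hf.mem_set_image.1 hx

theorem exists_mul_idempotent {S : Type*} [Semigroup S] [Finite S] (a : S) :
    ∃ w, (a * w) * (a * w) = a * w := by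
  let _ : TopologicalSpace S := ⊥
  have : DiscreteTopology S := ⟨rfl⟩
  obtain ⟨m, ⟨w, rfl⟩, hm⟩ := exists_idempotent_in_compact_subsemigroup
    (fun r : S => continuous_of_discreteTopology) (Set.range fun w => a * w)
    ⟨a * a, a, rfl⟩ (Set.toFinite _).isCompact (by
      rintro _ ⟨x, rfl⟩ _ ⟨y, rfl⟩
      exact ⟨x * (a * y), by simp only [mul_assoc]⟩)
  exact ⟨w, hm⟩

theorem exists_idempotent_mul {S : Type*} [Semigroup S] [Finite S] (a : S) :
    ∃ w, (w * a) * (w * a) = w * a := by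
  obtain ⟨w, hw⟩ := exists_mul_idempotent a
  refine ⟨w * a * w, ?_⟩
  calc w * a * w * a * (w * a * w * a) = w * ((a * w) * (a * w) * (a * w)) * a := by
        simp only [mul_assoc]
    _ = w * a * w * a := by rw [hw, hw]; simp only [mul_assoc]

/-! ### Idempotents are right identities, and each `θ x` is injective -/

namespace IsBijectivePentagon

theorem eq_of_mul_eq {S : Type*} [Semigroup S] {θ : S → S → S} (h : IsBijectivePentagon θ) {x y x' y' : S} (h₁ : x * y = x' * y')
    (h₂ : θ x y = θ x' y') : x = x' ∧ y = y' := by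
  exact Prod.ext_iff.1 (h.bijective.1 (a₁ := (x, y)) (a₂ := (x', y')) (Prod.ext h₁ h₂))

variable {S : Type*} [Semigroup S] [Finite S] {θ : S → S → S}

/-- The injective map `s` preserves the finite set `I × S`, hence permutes it. -/
theorem exists_mul_eq_of_rightIdeal (h : IsBijectivePentagon θ) {I : Set S}
    (hI : ∀ x ∈ I, ∀ y, x * y ∈ I) {u : S} (hu : u ∈ I) (v : S) :
    ∃ x ∈ I, ∃ y, x * y = u ∧ θ x y = v := by
  obtain ⟨⟨x, y⟩, hxy⟩ := h.bijective.2 (u, v)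
  obtain ⟨h₁, h₂⟩ := Prod.ext_iff.1 hxy
  refine ⟨x, ?_, y, h₁, h₂⟩
  exact Set.mem_of_apply_mem_of_mapsTo (T := {p : S × S | p.1 ∈ I}) h.bijective.1
    (fun _ hp => hI _ hp _) (x := (x, y)) (show x * y ∈ I from (show x * y = u from h₁) ▸ hu)

/-- The underlying semigroup is simple. -/
theorem mem_of_ideal (h : IsBijectivePentagon θ) {I : Set S}
    (hr : ∀ x ∈ I, ∀ y, x * y ∈ I) (hl : ∀ x ∈ I, ∀ y, y * x ∈ I) {z : S} (hz : z ∈ I) (x : S) :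
    x ∈ I :=
  Set.mem_of_apply_mem_of_mapsTo (T := {p : S × S | p.1 ∈ I}) h.bijective.1
    (fun _ hp => hr _ hp _) (x := (x, z)) (hl z hz x)

/-- If `u = x * y`, `v = θ x y` and `e * x = x`, then `θ e u = θ e x * v`. So right multiplication
by `v` covers the image, and finiteness does the rest. -/
theorem image_mul_right (h : IsBijectivePentagon θ) (e v : S) :
    (· * v) '' (θ e '' {t | e * t = t}) = θ e '' {t | e * t = t} ∧
      Set.InjOn (· * v) (θ e '' {t | e * t = t}) := by
  set J := θ e '' {t | e * t = t} with hJ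
  have hsub : J ⊆ (· * v) '' J := by
    rintro _ ⟨u, hu, rfl⟩
    obtain ⟨x, hx, y, rfl, rfl⟩ := h.exists_mul_eq_of_rightIdeal (I := {t | e * t = t})
      (fun x hx y => by simp only [Set.mem_ofPred_eq] at hx ⊢; rw [← mul_assoc, hx]) hu v
    exact ⟨θ e x, ⟨x, hx, rfl⟩, by simp only [h.map_mul]; rw [hx]⟩
  have hcard : ((· * v) '' J).ncard = J.ncard :=
    (Set.ncard_image_le (Set.toFinite J)).antisymm (Set.ncard_le_ncard hsub (Set.toFinite _))
  exact ⟨(Set.eq_of_subset_of_ncard_le hsub hcard.le (Set.toFinite _)).symm,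
    Set.injOn_of_ncard_image_eq hcard (Set.toFinite J)⟩

theorem mul_idempotent (h : IsBijectivePentagon θ) {v : S} (hv : v * v = v) (z : S) :
    z * v = z := by
  -- On the image from `image_mul_right`, right multiplication by an idempotent is injective and
  -- idempotent, hence the identity. The second clause makes `I` a right ideal, so simplicity gives
  -- `I = S`.
  let I : Set S := {z | (∀ v, v * v = v → z * v = z) ∧ ∀ c v, v * v = v → z * c * v = z * c}
  have hz : z ∈ I := by
    have key : ∀ x ∈ θ v '' {t | v * t = t}, ∀ w, w * w = w → x * w = x := fun x hx w hw => by
      obtain ⟨hJ, hinj⟩ := h.image_mul_right v w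
      exact hinj (hJ.subset ⟨x, hx, rfl⟩) hx (by simp only [mul_assoc, hw])
    refine h.mem_of_ideal (I := I) (z := θ v v) ?_ ?_ ⟨key _ ⟨v, hv, rfl⟩, fun c w hw => ?_⟩ z
    · rintro x ⟨-, hx⟩ y
      exact ⟨fun w hw => hx y w hw, fun c w hw => by rw [mul_assoc x, hx _ w hw]⟩
    · rintro x ⟨hx, hx'⟩ y
      exact ⟨fun w hw => by rw [mul_assoc, hx w hw],
        fun c w hw => by rw [mul_assoc y, mul_assoc y, hx' c w hw]⟩
    · exact key _ ((h.image_mul_right v c).1.subset ⟨_, ⟨v, hv, rfl⟩, rfl⟩) w hw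
  exact hz.1 v hv

theorem mul_right_cancel (h : IsBijectivePentagon θ) {x y u : S} (hxy : x * u = y * u) :
    x = y := by
  obtain ⟨w, hw⟩ := exists_mul_idempotent u
  rw [← h.mul_idempotent hw x, ← h.mul_idempotent hw y, ← mul_assoc, hxy, mul_assoc]

theorem mul_left_cancel (h : IsBijectivePentagon θ) {a e t t' : S} (ht : e * t = t)
    (ht' : e * t' = t') (hat : a * t = a * t') : t = t' := by
  obtain ⟨w, hw⟩ := exists_idempotent_mul a
  rw [← ht, ← ht', ← h.mul_idempotent hw e, mul_assoc e, mul_assoc e, mul_assoc w, mul_assoc w,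
    hat]

theorem exists_idempotent_mul_eq (h : IsBijectivePentagon θ) (x : S) :
    ∃ e, e * e = e ∧ e * x = x := by
  have hinj : Function.Injective fun y : S => y * x := fun _ _ => h.mul_right_cancel
  obtain ⟨e, he⟩ := Finite.surjective_of_injective hinj x
  refine ⟨e, h.mul_right_cancel (u := x) ?_, he⟩
  simp only at he
  rw [mul_assoc, he, he]

theorem injOn_of_idempotent (h : IsBijectivePentagon θ) {e : S} (he : e * e = e) :
    Set.InjOn (θ e) {t | e * t = t} := by
  refine Set.injOn_of_ncard_image_eq ((Set.ncard_image_le (Set.toFinite _)).antisymm ?_)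
    (Set.toFinite _)
  refine Set.ncard_le_ncard_of_injOn (fun t => θ e e * t) (fun t _ => ?_)
    (fun t ht t' ht' => h.mul_left_cancel ht ht') (Set.toFinite _)
  exact (h.image_mul_right e t).1.subset ⟨_, ⟨e, he, rfl⟩, rfl⟩

/-- If `e * x = x`, then `θ e (x * y) = θ e x * θ x y`. So `θ x y` determines `x * y`, and then `y`
because `s` is injective. -/
theorem injective (h : IsBijectivePentagon θ) (x : S) : Function.Injective (θ x) := by
  intro y y' hy
  obtain ⟨e, he, hx⟩ := h.exists_idempotent_mul_eq x
  refine (h.eq_of_mul_eq (h.injOn_of_idempotent he ?_ ?_ ?_) hy).2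
  · rw [Set.mem_ofPred_eq, ← mul_assoc, hx]
  · rw [Set.mem_ofPred_eq, ← mul_assoc, hx]
  · rw [h.map_mul, h.map_mul, hx, hy]

end IsBijectivePentagon

/-! ### The group of permutations `θ x` -/

/-- A bijective solution together with an idempotent `e` for which `θ e` is the identity. -/
structure IsPointedPentagon {S : Type*} [Semigroup S] (θ : S → S → S) (e : S) : Prop
    extends IsBijectivePentagon θ where
  idem : e * e = e
  unit : ∀ y, θ e y = y

theorem IsBijectivePentagon.exists_isPointedPentagon {S : Type*} [Semigroup S] [Finite S]
    [Nonempty S] {θ : S → S → S} (h : IsBijectivePentagon θ) : ∃ e, IsPointedPentagon θ e := by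
  obtain ⟨w, hw⟩ := exists_mul_idempotent (Classical.arbitrary S)
  set f := Classical.arbitrary S * w
  refine ⟨θ f f, h, ?_, fun y => ?_⟩
  · have := h.map_mul f f f
    rw [hw] at this
    exact this.symm
  · obtain ⟨z, rfl⟩ := (Finite.surjective_of_injective (h.injective f)) y
    have := h.comp f f z
    rwa [hw] at this

namespace IsPointedPentagon

variable {S : Type*} [Semigroup S] [Finite S] {θ : S → S → S} {e : S}

/-- `θ x` as a permutation. -/
noncomputable def perm (h : IsPointedPentagon θ e) (x : S) : Equiv.Perm S :=
  Equiv.ofBijective (θ x) (Finite.injective_iff_bijective.1 (h.injective x))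

theorem perm_mul_perm (h : IsPointedPentagon θ e) (x y : S) :
    h.perm (θ x y) * h.perm (x * y) = h.perm y :=
  Equiv.ext fun z => h.comp x y z

theorem perm_unit (h : IsPointedPentagon θ e) : h.perm e = 1 :=
  Equiv.ext h.unit

/-- The permutations `θ x` form a group. -/
noncomputable def permGroup (h : IsPointedPentagon θ e) : Subgroup (Equiv.Perm S) where
  carrier := Set.range h.perm
  mul_mem' := by
    rintro _ _ ⟨v, rfl⟩ ⟨u, rfl⟩
    -- With `u = x * y` and `v = θ x y`, the third law reads `θ v ∘ θ u = θ y`.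
    obtain ⟨⟨x, y⟩, hxy⟩ := h.bijective.2 (u, v)
    obtain ⟨rfl, rfl⟩ := Prod.ext_iff.1 hxy
    exact ⟨y, (h.perm_mul_perm x y).symm⟩
  one_mem' := ⟨e, h.perm_unit⟩
  inv_mem' := by
    rintro _ ⟨x, rfl⟩
    refine ⟨θ x e, eq_inv_of_mul_eq_one_left ?_⟩
    have := h.perm_mul_perm x e
    rwa [h.mul_idempotent h.idem, h.perm_unit] at this

/-- The map `x ↦ θ x` into the group of all these permutations. -/
noncomputable def toPermGroup (h : IsPointedPentagon θ e) (x : S) : h.permGroup :=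
  ⟨h.perm x, x, rfl⟩

theorem toPermGroup_surjective (h : IsPointedPentagon θ e) (a : h.permGroup) :
    ∃ x, h.toPermGroup x = a := by
  obtain ⟨_, x, rfl⟩ := a
  exact ⟨x, rfl⟩

@[simp]
theorem toPermGroup_apply (h : IsPointedPentagon θ e) (x y : S) :
    (h.toPermGroup x : Equiv.Perm S) y = θ x y := rfl

theorem toPermGroup_mul_toPermGroup (h : IsPointedPentagon θ e) (x y : S) :
    h.toPermGroup (θ x y) * h.toPermGroup (x * y) = h.toPermGroup y :=
  Subtype.ext (h.perm_mul_perm x y)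

/-- Since `θ (p * y) = (θ (θ p y))⁻¹ ∘ θ y`, only `θ p` matters; this makes `rightAct` well defined.
-/
theorem toPermGroup_mul_congr (h : IsPointedPentagon θ e) {p q : S}
    (hpq : h.toPermGroup p = h.toPermGroup q) (y : S) :
    h.toPermGroup (p * y) = h.toPermGroup (q * y) := by
  have hy : θ p y = θ q y := by rw [← toPermGroup_apply h, hpq, toPermGroup_apply]
  have hp := h.toPermGroup_mul_toPermGroup p y
  rw [← h.toPermGroup_mul_toPermGroup q y, hy] at hp
  exact mul_left_cancel hp

theorem apply_mul_self (h : IsPointedPentagon θ e) {f : S} (hf : f * f = f) (x : S) :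
    θ x f * θ x f = θ x f := by
  have := h.map_mul x f f
  rw [hf, h.mul_idempotent hf] at this
  exact this.symm

theorem permGroup_apply_mul_self (h : IsPointedPentagon θ e) {f : S} (hf : f * f = f)
    (a : h.permGroup) : (a : Equiv.Perm S) f * (a : Equiv.Perm S) f = (a : Equiv.Perm S) f := by
  obtain ⟨x, rfl⟩ := h.toPermGroup_surjective a
  exact h.apply_mul_self hf x

theorem toPermGroup_apply_idempotent (h : IsPointedPentagon θ e) {f : S} (hf : f * f = f)
    (x : S) : h.toPermGroup (θ x f) = h.toPermGroup f * (h.toPermGroup x)⁻¹ := by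
  have := h.toPermGroup_mul_toPermGroup x f
  rw [h.mul_idempotent hf] at this
  exact eq_mul_inv_of_mul_eq this

theorem toPermGroup_inv_apply (h : IsPointedPentagon θ e) {f : S} (hf : f * f = f)
    (hf' : h.toPermGroup f = 1) (a : h.permGroup) :
    h.toPermGroup (((a⁻¹ : h.permGroup) : Equiv.Perm S) f) = a := by
  obtain ⟨x, hx⟩ := h.toPermGroup_surjective a⁻¹
  rw [← hx, toPermGroup_apply, h.toPermGroup_apply_idempotent hf, hf', hx, inv_inv, one_mul]

theorem unit_mul_apply (h : IsPointedPentagon θ e) (a : h.permGroup) (y : S) :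
    e * (a : Equiv.Perm S) (e * y) = e * (a : Equiv.Perm S) y := by
  obtain ⟨x, rfl⟩ := h.toPermGroup_surjective a
  rw [toPermGroup_apply, toPermGroup_apply, h.map_mul, h.mul_idempotent h.idem, ← mul_assoc,
    h.mul_idempotent (h.apply_mul_self h.idem x)]

/-! ### The group `e S` and the matched pair -/

/-- The subset `e S`, which is a group. -/
def Fixed (_ : IsPointedPentagon θ e) : Type _ := {x : S // e * x = x}

theorem Fixed.exists_mul_eq (h : IsPointedPentagon θ e) (x : h.Fixed) :
    ∃ y : h.Fixed, x.1 * y.1 = e := by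
  have : Finite h.Fixed := inferInstanceAs (Finite {x : S // e * x = x})
  have hinj : Function.Injective fun y : h.Fixed =>
      (⟨x.1 * y.1, by rw [← mul_assoc, x.2]⟩ : h.Fixed) := fun y z hyz =>
    Subtype.ext (h.mul_left_cancel y.2 z.2 (Subtype.ext_iff.1 hyz))
  obtain ⟨y, hy⟩ := Finite.surjective_of_injective hinj ⟨e, h.idem⟩
  exact ⟨y, Subtype.ext_iff.1 hy⟩

noncomputable instance (h : IsPointedPentagon θ e) : Group h.Fixed :=
  letI : Mul h.Fixed := ⟨fun x y => ⟨x.1 * y.1, by rw [← mul_assoc, x.2]⟩⟩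
  letI : One h.Fixed := ⟨⟨e, h.idem⟩⟩
  letI : Inv h.Fixed := ⟨fun x => (Fixed.exists_mul_eq h x).choose⟩
  Group.ofRightAxioms (fun _ _ _ => Subtype.ext (mul_assoc _ _ _))
    (fun x => Subtype.ext (h.mul_idempotent h.idem x.1))
    (fun x => Subtype.ext (Fixed.exists_mul_eq h x).choose_spec)

@[simp]
theorem Fixed.val_mul (h : IsPointedPentagon θ e) (x y : h.Fixed) :
    (x * y).1 = x.1 * y.1 := rfl

@[simp]
theorem Fixed.val_one (h : IsPointedPentagon θ e) : (1 : h.Fixed).1 = e := rfl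

/-- The projection of `S` onto `e S`. -/
def toFixed (h : IsPointedPentagon θ e) (x : S) : h.Fixed :=
  ⟨e * x, by rw [← mul_assoc, h.idem]⟩

@[simp]
theorem toFixed_val (h : IsPointedPentagon θ e) (x : S) : (h.toFixed x).1 = e * x := rfl

noncomputable instance (h : IsPointedPentagon θ e) : MulAction h.permGroup h.Fixed where
  smul a x := h.toFixed ((a : Equiv.Perm S) x.1)
  one_smul x := Subtype.ext x.2
  mul_smul a b x := Subtype.ext (h.unit_mul_apply a ((b : Equiv.Perm S) x.1)).symm

theorem Fixed.val_smul (h : IsPointedPentagon θ e) (a : h.permGroup) (x : h.Fixed) :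
    (a • x).1 = e * (a : Equiv.Perm S) x.1 := rfl

/-- The right action of `e S` on the group of permutations, `θ p ↦ θ (p * x)`. -/
noncomputable def rightAct (h : IsPointedPentagon θ e) (x : h.Fixed) (a : h.permGroup) :
    h.permGroup :=
  h.toPermGroup ((h.toPermGroup_surjective a).choose * x.1)

theorem rightAct_toPermGroup (h : IsPointedPentagon θ e) (x : h.Fixed) (p : S) :
    h.rightAct x (h.toPermGroup p) = h.toPermGroup (p * x.1) :=
  h.toPermGroup_mul_congr (h.toPermGroup_surjective (h.toPermGroup p)).choose_spec _

theorem rightAct_one (h : IsPointedPentagon θ e) (a : h.permGroup) : h.rightAct 1 a = a := by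
  obtain ⟨p, rfl⟩ := h.toPermGroup_surjective a
  rw [rightAct_toPermGroup, Fixed.val_one, h.mul_idempotent h.idem]

theorem rightAct_mul (h : IsPointedPentagon θ e) (x y : h.Fixed) (a : h.permGroup) :
    h.rightAct (x * y) a = h.rightAct y (h.rightAct x a) := by
  obtain ⟨p, rfl⟩ := h.toPermGroup_surjective a
  simp only [rightAct_toPermGroup, Fixed.val_mul, mul_assoc]

theorem rightAct_eq (h : IsPointedPentagon θ e) (x : h.Fixed) (a : h.permGroup) :
    h.rightAct x a = (h.toPermGroup ((a : Equiv.Perm S) x.1))⁻¹ * h.toPermGroup x.1 := by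
  obtain ⟨p, rfl⟩ := h.toPermGroup_surjective a
  rw [rightAct_toPermGroup]
  exact eq_inv_mul_of_mul_eq (h.toPermGroup_mul_toPermGroup p x.1)

theorem rightAct_toFixed (h : IsPointedPentagon θ e) (y : S) (a : h.permGroup) :
    h.rightAct (h.toFixed y) a =
      (h.toPermGroup ((a : Equiv.Perm S) y))⁻¹ * h.toPermGroup y := by
  obtain ⟨p, rfl⟩ := h.toPermGroup_surjective a
  rw [rightAct_toPermGroup, toFixed_val, ← mul_assoc, h.mul_idempotent h.idem]
  exact eq_inv_mul_of_mul_eq (h.toPermGroup_mul_toPermGroup p y)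

/-- The matched pair of groups attached to a bijective solution. -/
noncomputable def matchedPair (h : IsPointedPentagon θ e) :
    MatchedPair h.permGroup h.Fixed where
  σ := MulAction.toPermHom h.permGroup h.Fixed
  δ x :=
    { toFun := h.rightAct x
      invFun := h.rightAct x⁻¹
      left_inv := fun a => by rw [← rightAct_mul, mul_inv_cancel, rightAct_one]
      right_inv := fun a => by rw [← rightAct_mul, inv_mul_cancel, rightAct_one] }
  δ_one := Equiv.ext h.rightAct_one
  δ_mul x y := Equiv.ext (h.rightAct_mul x y)
  σ_mul_apply a x y := by
    obtain ⟨p, rfl⟩ := h.toPermGroup_surjective a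
    refine Subtype.ext ?_
    simp only [MulAction.toPermHom_apply, MulAction.toPerm_apply, Equiv.coe_fn_mk,
      rightAct_toPermGroup, Fixed.val_smul, Fixed.val_mul, toPermGroup_apply, h.map_mul]
    rw [mul_assoc, ← mul_assoc (θ p x.1) e, h.mul_idempotent h.idem]
  δ_apply_mul x a b := by
    change h.rightAct x (a * b) =
      h.rightAct (h.toFixed ((b : Equiv.Perm S) x.1)) a * h.rightAct x b
    -- The product telescopes: the two factors `θ (b x)` cancel.
    rw [rightAct_toFixed, rightAct_eq, rightAct_eq, mul_assoc, mul_inv_cancel_left]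
    rfl

/-! ### Coordinates on `S` -/

/-- The idempotent `f` with `f * p = p`. -/
noncomputable def leftUnit (h : IsPointedPentagon θ e) (p : S) : S :=
  (h.exists_idempotent_mul_eq p).choose

theorem leftUnit_mul_self (h : IsPointedPentagon θ e) (p : S) :
    h.leftUnit p * h.leftUnit p = h.leftUnit p :=
  (h.exists_idempotent_mul_eq p).choose_spec.1

theorem leftUnit_mul (h : IsPointedPentagon θ e) (p : S) : h.leftUnit p * p = p :=
  (h.exists_idempotent_mul_eq p).choose_spec.2

theorem leftUnit_eq (h : IsPointedPentagon θ e) {f p : S} (hf : f * p = p) :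
    h.leftUnit p = f :=
  h.mul_right_cancel ((h.leftUnit_mul p).trans hf.symm)

/-- The decomposition of `S` into idempotents with trivial `θ`, permutations `θ x`, and `e S`. -/
noncomputable def decomposition (h : IsPointedPentagon θ e) :
    S ≃ {f : S // f * f = f ∧ h.toPermGroup f = 1} × h.permGroup × h.Fixed where
  toFun p := (⟨θ (h.leftUnit p) (h.leftUnit p), h.apply_mul_self (h.leftUnit_mul_self p) _, by
    rw [h.toPermGroup_apply_idempotent (h.leftUnit_mul_self p), mul_inv_cancel]⟩,
    h.toPermGroup (h.leftUnit p), h.toFixed p)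
  invFun q := ((q.2.1⁻¹ : h.permGroup) : Equiv.Perm S) q.1.1 * q.2.2.1
  left_inv p := by
    change (h.toPermGroup (h.leftUnit p) : Equiv.Perm S).symm
      ((h.toPermGroup (h.leftUnit p) : Equiv.Perm S) (h.leftUnit p)) * (e * p) = p
    rw [Equiv.symm_apply_apply, ← mul_assoc, h.mul_idempotent h.idem, h.leftUnit_mul]
  right_inv := by
    rintro ⟨⟨f, hf, hf'⟩, a, x⟩
    have hi := h.permGroup_apply_mul_self hf a⁻¹
    have ha := h.toPermGroup_inv_apply hf hf' a
    have hp : h.leftUnit (((a⁻¹ : h.permGroup) : Equiv.Perm S) f * x.1) =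
        ((a⁻¹ : h.permGroup) : Equiv.Perm S) f :=
      h.leftUnit_eq (by rw [← mul_assoc, hi])
    refine Prod.ext (Subtype.ext ?_) (Prod.ext ?_ (Subtype.ext ?_))
    · change θ (h.leftUnit _) (h.leftUnit _) = f
      rw [hp, ← toPermGroup_apply h, ha]
      exact (a : Equiv.Perm S).apply_symm_apply f
    · change h.toPermGroup (h.leftUnit _) = a
      rw [hp, ha]
    · change e * (_ * x.1) = x.1
      rw [← mul_assoc, h.mul_idempotent hi, x.2]

theorem decomposition_eq (h : IsPointedPentagon θ e) (p q : S) :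
    Prod.map h.decomposition h.decomposition (p * q, θ p q) =
      matchedPairMap h.matchedPair (fun _ => 1) (h.decomposition p, h.decomposition q) := by
  have hpq : h.leftUnit (p * q) = h.leftUnit p :=
    h.leftUnit_eq (by rw [← mul_assoc, h.leftUnit_mul])
  have hidem := h.leftUnit_mul_self q
  have hθ : h.leftUnit (θ p q) = θ p (h.leftUnit q) := h.leftUnit_eq (by
    have := h.map_mul p (h.leftUnit q) q
    rw [h.leftUnit_mul, h.mul_idempotent hidem] at this
    exact this.symm)
  have hδ : h.rightAct (h.toFixed p) (h.toPermGroup (h.leftUnit p)) = h.toPermGroup p := by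
    rw [rightAct_toPermGroup, toFixed_val, ← mul_assoc, h.mul_idempotent h.idem, h.leftUnit_mul]
  refine Prod.ext (Prod.ext (Subtype.ext ?_) (Prod.ext ?_ (Subtype.ext ?_)))
    (Prod.ext (Subtype.ext ?_) (Prod.ext ?_ (Subtype.ext ?_)))
  · change θ (h.leftUnit (p * q)) (h.leftUnit (p * q)) = θ (h.leftUnit p) (h.leftUnit p)
    rw [hpq]
  · change h.toPermGroup (h.leftUnit (p * q)) = h.toPermGroup (h.leftUnit p)
    rw [hpq]
  · change e * (p * q) = (e * p) * (e * q)
    rw [mul_assoc, ← mul_assoc p, h.mul_idempotent h.idem]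
  · change θ (h.leftUnit (θ p q)) (h.leftUnit (θ p q)) = θ (h.leftUnit q) (h.leftUnit q)
    -- For `f = leftUnit q`, `p * f = p` turns the third law into `θ (θ p f) (θ p f) = θ f f`: the
    -- `X`-coordinate of `q` is unchanged, so `φ` is trivial.
    have := h.comp p (h.leftUnit q) (h.leftUnit q)
    rwa [h.mul_idempotent hidem, ← hθ, hθ, ← hθ] at this
  · change h.toPermGroup (h.leftUnit (θ p q)) = h.toPermGroup (h.leftUnit q) *
      (h.rightAct (h.toFixed p) (h.toPermGroup (h.leftUnit p)))⁻¹
    rw [hδ, hθ, h.toPermGroup_apply_idempotent hidem]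
  · change e * θ p q =
      e * (h.rightAct (h.toFixed p) (h.toPermGroup (h.leftUnit p)) : Equiv.Perm S) (e * q)
    rw [hδ, h.unit_mul_apply, toPermGroup_apply]

end IsPointedPentagon

namespace IsPentagonSolution

variable {S : Type*} {s : S × S → S × S}

theorem apply_eq (h : IsPentagonSolution s) (x y z : S) :
    (s ((s (x, y)).1, z)).1 = (s (x, (s (y, z)).1)).1 ∧
      (s ((s (x, y)).2, (s ((s (x, y)).1, z)).2)).1 = (s (x, (s (y, z)).1)).2 ∧
      (s ((s (x, y)).2, (s ((s (x, y)).1, z)).2)).2 = (s (y, z)).2 := by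
  have := congrFun h (x, y, z)
  simpa [pentagon12, pentagon13, pentagon23, Prod.ext_iff] using this

/-- The first component of a solution is an associative multiplication. -/
abbrev semigroup (h : IsPentagonSolution s) : Semigroup S where
  mul x y := (s (x, y)).1
  mul_assoc x y z := (h.apply_eq x y z).1

theorem isBijectivePentagon (h : IsPentagonSolution s) (hs : Function.Bijective s) :
    letI := h.semigroup
    IsBijectivePentagon fun x y : S => (s (x, y)).2 :=
  letI := h.semigroup
  { map_mul := fun x y z => (h.apply_eq x y z).2.1.symm
    comp := fun x y z => (h.apply_eq x y z).2.2
    bijective := hs }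

end IsPentagonSolution

/-! ### The converse: matched pairs give bijective solutions -/

namespace MatchedPair

variable {A G X : Type*} [Group A] [Group G] (M : MatchedPair A G) (φ : A → Equiv.Perm X)

theorem δ_apply_one (x : G) : M.δ x 1 = 1 := by
  have := M.δ_apply_mul x 1 1
  rw [map_one M.σ, mul_one, Equiv.Perm.one_apply] at this
  exact left_eq_mul.1 this

theorem δ_σ_inv (d : A) (y : G) : M.δ (M.σ d y) d⁻¹ = (M.δ y d)⁻¹ := by
  have := M.δ_apply_mul y d⁻¹ d
  rw [inv_mul_cancel, δ_apply_one] at this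
  exact eq_inv_of_mul_eq_one_left this.symm

theorem δ_mul_apply (x y : G) (a : A) : M.δ (x * y) a = M.δ y (M.δ x a) := by
  rw [δ_mul, Equiv.Perm.mul_apply]

theorem σ_apply_apply (a b : A) (x : G) : M.σ a (M.σ b x) = M.σ (a * b) x := by
  rw [map_mul, Equiv.Perm.mul_apply]

theorem isPentagonSolution : IsPentagonSolution (matchedPairMap M φ) := by
  funext ⟨⟨α, a, x⟩, ⟨β, b, y⟩, ⟨γ, c, z⟩⟩
  have key : M.δ (M.σ (M.δ x a) y) (b * (M.δ x a)⁻¹) = M.δ y b * (M.δ (x * y) a)⁻¹ := by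
    rw [δ_apply_mul, δ_σ_inv, σ_apply_apply, inv_mul_cancel, map_one M.σ, Equiv.Perm.one_apply,
      δ_mul_apply]
  simp only [Function.comp_apply, pentagon12, pentagon13, pentagon23, matchedPairMap, key,
    σ_apply_apply, M.σ_mul_apply, ← M.δ_mul_apply, mul_assoc, mul_inv_rev, inv_inv,
    inv_mul_cancel_left, inv_mul_cancel, mul_one, Equiv.apply_symm_apply]

theorem bijective : Function.Bijective (matchedPairMap M φ) := by
  constructor
  · rintro ⟨⟨α, a, x⟩, β, b, y⟩ ⟨⟨α', a', x'⟩, β', b', y'⟩ h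
    simp only [matchedPairMap, Prod.mk.injEq] at h
    obtain ⟨⟨rfl, rfl, hxy⟩, hβ, hb, hy⟩ := h
    -- With `d = δ_x(a)`, `u = x * y` and `v = σ_d(y)`, one has `δ_v(d⁻¹) = (δ_u(a))⁻¹`, so the
    -- output determines `d`.
    have hδ : M.δ x a = M.δ x' a := by
      have h₁ := M.δ_σ_inv (M.δ x a) y
      rw [hy, ← δ_mul_apply, hxy, δ_mul_apply, ← M.δ_σ_inv (M.δ x' a) y'] at h₁
      exact inv_injective ((M.δ _).injective h₁)
    rw [hδ] at hy hb hβ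
    obtain rfl := (M.σ _).injective hy
    obtain rfl := mul_right_cancel hxy
    obtain rfl := mul_right_cancel hb
    obtain rfl := (φ _).injective ((φ _).symm.injective hβ)
    rfl
  · rintro ⟨⟨α, a, u⟩, β, c, v⟩
    -- The same relation, solved for `d' = d⁻¹`.
    obtain ⟨d', hd'⟩ := (M.δ v).surjective (M.δ u a)⁻¹
    obtain ⟨y, rfl⟩ := (M.σ d'⁻¹).surjective v
    have hd : M.δ (u * y⁻¹) a = d'⁻¹ := by
      have h₁ := M.δ_σ_inv d'⁻¹ y
      rw [inv_inv, hd', inv_inj] at h₁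
      rw [δ_mul_apply, h₁, ← δ_mul_apply, mul_inv_cancel, δ_one, Equiv.Perm.one_apply]
    refine ⟨((α, a, u * y⁻¹), (φ (c * d'⁻¹)).symm (φ c β), c * d'⁻¹, y), ?_⟩
    simp only [matchedPairMap, hd, inv_mul_cancel_right, mul_inv_cancel_right,
      Equiv.apply_symm_apply, Equiv.symm_apply_apply]

end MatchedPair

theorem theorem1p1 :
    (∀ (S : Type u) [Finite S] (s : S × S → S × S),
      IsPentagonSolution s → Function.Bijective s →
      ∃ (A G X : Type u) (_ : Group A) (_ : Group G) (M : MatchedPair A G)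
        (φ : A → Equiv.Perm X) (e : S ≃ X × A × G),
        ∀ p q : S, Prod.map e e (s (p, q)) = matchedPairMap M φ (e p, e q)) ∧
    (∀ (A : Type v₁) (G : Type v₂) (X : Type v₃) [Group A] [Group G]
      (M : MatchedPair A G) (φ : A → Equiv.Perm X),
      IsPentagonSolution (matchedPairMap M φ) ∧
        Function.Bijective (matchedPairMap M φ)) := by
  refine ⟨fun S _ s hs hb => ?_, fun A G X _ _ M φ => ⟨M.isPentagonSolution φ, M.bijective φ⟩⟩
  rcases isEmpty_or_nonempty S with hS | hS
  · exact ⟨PUnit, PUnit, S, inferInstance, inferInstance,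
      ⟨1, 1, rfl, fun _ _ => rfl, fun _ _ _ => rfl, fun _ _ _ => rfl⟩, 1, Equiv.equivOfIsEmpty _ _,
      fun p => isEmptyElim p⟩
  · let _ := hs.semigroup
    obtain ⟨e, h⟩ := (hs.isBijectivePentagon hb).exists_isPointedPentagon
    exact ⟨h.permGroup, h.Fixed, _, inferInstance, inferInstance, h.matchedPair, fun _ => 1,
      h.decomposition, h.decomposition_eq⟩
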